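/- Let $K$ be a field of characteristic $0$, and let $A_1$ be the first Weyl algebra over $K$, i.e. the associative unital $K$-algebra generated by $p,q$ subject to the relation $[p,q]=pq-qp=1$. For $t\in\mathbb{Z}$ let $D_t$ be the $K$-linear span of the elements $p^iq^s$ with $i,s\ge 0$ and $s-i=t$ (this is the $t$-eigenspace of $\mathrm{ad}(pq)\colon x\mapsto [pq,x]$), and call an element of $A_1$ homogeneous if it lies in some $D_t$. Let $z,w\in A_1$ satisfy $[z,w]=zw-wz=1$. If $z$ is a sum of at most two homogeneous elements of $A_1$, then $z$ and $w$ generate $A_1$ as a $K$-algebra. -/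

import Mathlib

/-- The defining relation `p q = q p + 1` of the first Weyl algebra, where `p` and `q` are the
free generators indexed by `0` and `1`. -/
inductive WeylRel (K : Type*) [Field K] : FreeAlgebra K (Fin 2) → FreeAlgebra K (Fin 2) → Prop
  | comm : WeylRel K (FreeAlgebra.ι K 0 * FreeAlgebra.ι K 1)
      (FreeAlgebra.ι K 1 * FreeAlgebra.ι K 0 + 1)

/-- The first Weyl algebra `A₁` over `K`: the associative unital `K`-algebra generated by `p, q`
subject to the relation `p q - q p = 1`. -/
abbrev WeylAlgebra (K : Type*) [Field K] : Type _ := RingQuot (WeylRel K)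

namespace WeylAlgebra

/-- The standard generator `p` of `A₁`. -/
noncomputable def p (K : Type*) [Field K] : WeylAlgebra K :=
  RingQuot.mkAlgHom K (WeylRel K) (FreeAlgebra.ι K 0)

/-- The standard generator `q` of `A₁`. -/
noncomputable def q (K : Type*) [Field K] : WeylAlgebra K :=
  RingQuot.mkAlgHom K (WeylRel K) (FreeAlgebra.ι K 1)

/-- The homogeneous component `D_t = Span {p^i q^s | s - i = t}` of degree `t : ℤ`. -/
noncomputable def D (K : Type*) [Field K] (t : ℤ) : Submodule K (WeylAlgebra K) :=
  Submodule.span K {x | ∃ i s : ℕ, (s : ℤ) - (i : ℤ) = t ∧ x = p K ^ i * q K ^ s}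

/-- An element of `A₁` is homogeneous if it lies in some `D_t`. -/
def IsHomogeneous {K : Type*} [Field K] (z : WeylAlgebra K) : Prop :=
  ∃ t : ℤ, z ∈ D K t

end WeylAlgebra

/-! With `h = pq`, the Weyl algebra maps to the skew Laurent ring of sums of `f(h) x^k`, `x h = (h -
1) x`, by `q ↦ x`, `p ↦ h x⁻¹`. What is used is the image of `[z, w] = 1`, and the fact that the
coefficient of `x^(-n)` in an image is divisible by `h(h+1)...(h+n-1)`, hence zero or of degree at
least `n`. To leading order in `h`, the commutator of `f x^a` and `v x^j` is a Poisson bracket with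
factor `j deg f - a deg v`; the argument turns on when this factor vanishes.

If both degrees in `z` have the same sign, a Fourier automorphism makes them nonnegative, and the
lowest components of `w` force `z = c q + d` (`eq_smul_q_add_of_commutator`).

If `z = f x^(-r) + g x^s` with `r, s > 0`, weight `h` and `x` so that both terms have the same
weight `N`. As long as the leading form of `w` is too heavy to produce `1`, it Poisson-commutes with
that of `z`; a two-term recursion makes it proportional to the leading form of some `z^j`, and
subtracting a multiple of `z^j` from `w` lowers the weight (`exists_weightLE_pred`). At minimal
weight the ends of the recursion give `N ≤ s` or `N ≤ r`, and `deg f ≥ r` leaves only `z = c p^r + d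
q^s` with `r = 1` or `s = 1` (`natDegree_eq_of_weightLE_one`).

In every case `z` has a partner `y` with `[z, y] = 1` that generates the algebra with it. Then `w -
y` lies in the centralizer of `z`, which is `K[z]`, so `z` and `w` generate too
(`adjoin_pair_eq_top_of_commutator`). -/

open Polynomial

/-! ### Degree bounds with integer exponents, and leading terms of commutators. -/

section Degree

variable {K : Type*} [Field K]

/-- `f` has no monomials of degree exceeding the integer `m`. -/
def Polynomial.DegLE (f : K[X]) (m : ℤ) : Prop := ∀ i : ℕ, m < i → f.coeff i = 0

/-- The coefficient of `f` at an integer exponent, zero at negative exponents. -/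
noncomputable def Polynomial.zcoeff (f : K[X]) (m : ℤ) : K := if 0 ≤ m then f.coeff m.toNat else 0

namespace Polynomial

@[simp] theorem zcoeff_natCast (f : K[X]) (n : ℕ) : f.zcoeff n = f.coeff n := by
  simp [zcoeff]

theorem zcoeff_of_neg (f : K[X]) {m : ℤ} (h : m < 0) : f.zcoeff m = 0 := by
  simp [zcoeff, not_le.mpr h]

@[simp] theorem zcoeff_zero (m : ℤ) : (0 : K[X]).zcoeff m = 0 := by simp [zcoeff]

theorem zcoeff_sub (f g : K[X]) (m : ℤ) : (f - g).zcoeff m = f.zcoeff m - g.zcoeff m := by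
  unfold zcoeff; split_ifs <;> simp

theorem zcoeff_add (f g : K[X]) (m : ℤ) : (f + g).zcoeff m = f.zcoeff m + g.zcoeff m := by
  unfold zcoeff; split_ifs <;> simp

theorem zcoeff_smul (c : K) (f : K[X]) (m : ℤ) : (c • f).zcoeff m = c * f.zcoeff m := by
  unfold zcoeff; split_ifs <;> simp

theorem zcoeff_one (m : ℤ) : (1 : K[X]).zcoeff m = if m = 0 then 1 else 0 := by
  rcases lt_or_ge m 0 with h | h
  · rw [zcoeff_of_neg _ h, if_neg h.ne]
  · lift m to ℕ using h
    simp [coeff_one]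

theorem degLE_natCast {f : K[X]} {n : ℕ} : f.DegLE n ↔ f.natDegree ≤ n := by
  rw [natDegree_le_iff_coeff_eq_zero]
  simp [DegLE]

/-- Negative bounds are allowed, so bounds can be shifted freely in weight computations. -/
theorem DegLE.eq_zero {f : K[X]} {m : ℤ} (h : f.DegLE m) (hm : m < 0) : f = 0 := by
  ext i
  exact h i (by lia)

theorem degLE_zero (m : ℤ) : (0 : K[X]).DegLE m := fun _ _ => coeff_zero _

theorem degLE_natDegree (f : K[X]) : f.DegLE f.natDegree := degLE_natCast.2 le_rfl

theorem DegLE.mono {f : K[X]} {m n : ℤ} (h : f.DegLE m) (hmn : m ≤ n) : f.DegLE n :=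
  fun i hi => h i (by lia)

theorem DegLE.sub {f g : K[X]} {m : ℤ} (hf : f.DegLE m) (hg : g.DegLE m) : (f - g).DegLE m :=
  fun i hi => by rw [coeff_sub, hf i hi, hg i hi, sub_zero]

theorem DegLE.add {f g : K[X]} {m : ℤ} (hf : f.DegLE m) (hg : g.DegLE m) : (f + g).DegLE m :=
  fun i hi => by rw [coeff_add, hf i hi, hg i hi, add_zero]

theorem DegLE.smul {f : K[X]} {m : ℤ} (hf : f.DegLE m) (c : K) : (c • f).DegLE m :=
  fun i hi => by rw [coeff_smul, hf i hi, smul_zero]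

theorem DegLE.pred {f : K[X]} {m : ℤ} (hf : f.DegLE m) (h : f.zcoeff m = 0) :
    f.DegLE (m - 1) := by
  intro i hi
  rcases (show m ≤ i by lia).lt_or_eq with h' | rfl
  · exact hf i h'
  · simpa using h

theorem DegLE.mul {f g : K[X]} {m n : ℤ} (hf : f.DegLE m) (hg : g.DegLE n) :
    (f * g).DegLE (m + n) := by
  rcases lt_or_ge m 0 with h | h
  · rw [hf.eq_zero h, zero_mul]; exact degLE_zero _
  rcases lt_or_ge n 0 with h' | h'
  · rw [hg.eq_zero h', mul_zero]; exact degLE_zero _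
  lift m to ℕ using h
  lift n to ℕ using h'
  rw [← Nat.cast_add, degLE_natCast]
  exact natDegree_mul_le_of_le (degLE_natCast.1 hf) (degLE_natCast.1 hg)

theorem DegLE.zcoeff_mul {f g : K[X]} {m n : ℤ} (hf : f.DegLE m) (hg : g.DegLE n) :
    (f * g).zcoeff (m + n) = f.zcoeff m * g.zcoeff n := by
  rcases lt_or_ge m 0 with h | h
  · rw [hf.eq_zero h]; simp
  rcases lt_or_ge n 0 with h' | h'
  · rw [hg.eq_zero h']; simp
  lift m to ℕ using h
  lift n to ℕ using h'
  rw [← Nat.cast_add, zcoeff_natCast, zcoeff_natCast, zcoeff_natCast]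
  exact coeff_mul_add_eq_of_natDegree_le (degLE_natCast.1 hf) (degLE_natCast.1 hg)

theorem DegLE.taylor {f : K[X]} {m : ℤ} (hf : f.DegLE m) (c : K) : (taylor c f).DegLE m := by
  rcases lt_or_ge m 0 with h | h
  · rw [hf.eq_zero h, map_zero]; exact degLE_zero _
  lift m to ℕ using h
  rw [degLE_natCast, natDegree_taylor, ← degLE_natCast]
  exact hf

theorem DegLE.zcoeff_taylor {f : K[X]} {m : ℤ} (hf : f.DegLE m) (c : K) :
    (Polynomial.taylor c f).zcoeff m = f.zcoeff m := by
  rcases lt_or_ge m 0 with h | h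
  · rw [zcoeff_of_neg _ h, zcoeff_of_neg _ h]
  lift m to ℕ using h
  rw [zcoeff_natCast, zcoeff_natCast]
  rcases (degLE_natCast.1 hf).lt_or_eq with h | h
  · rw [coeff_eq_zero_of_natDegree_lt h, coeff_eq_zero_of_natDegree_lt (by rwa [natDegree_taylor])]
  · rw [← h, coeff_taylor_natDegree, leadingCoeff]

theorem DegLE.taylor_sub {f : K[X]} {m : ℤ} (hf : f.DegLE m) (c : K) :
    (Polynomial.taylor c f - f).DegLE (m - 1) := by
  refine ((hf.taylor c).sub hf).pred ?_
  rw [zcoeff_sub, hf.zcoeff_taylor, sub_self]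

theorem DegLE.zcoeff_taylor_sub {f : K[X]} {m : ℤ} (hf : f.DegLE m) (c : K) :
    (Polynomial.taylor c f - f).zcoeff (m - 1) = c * m * f.zcoeff m := by
  rcases lt_or_ge m 0 with h | h
  · rw [zcoeff_of_neg _ h, zcoeff_of_neg _ (by lia), mul_zero]
  lift m to ℕ using h
  rcases m with _ | m
  · simp [zcoeff_of_neg]
  rw [Nat.cast_succ, add_sub_cancel_right, ← Nat.cast_succ, zcoeff_natCast, zcoeff_natCast,
    coeff_sub, taylor_coeff]
  -- The coefficient of `X^m` in `f(X + c)` is this Hasse derivative at `c`. It is linear because `m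
  -- + 1` bounds the degree of `f`.
  have h1 : (hasseDeriv m f).natDegree ≤ 1 := by
    refine (natDegree_hasseDeriv_le f m).trans ?_
    have := degLE_natCast.1 hf
    lia
  rw [eval_eq_sum_range' (n := 2) (by lia), Finset.sum_range_succ, Finset.sum_range_one,
    hasseDeriv_coeff, hasseDeriv_coeff]
  simp [add_comm 1 m]
  ring

/-- The coefficient of `x ^ (a + j)` in the commutator of `f x ^ a` and `v x ^ j`. -/
noncomputable def skewBracket (a : ℤ) (f : K[X]) (j : ℤ) (v : K[X]) : K[X] :=
  f * taylor (-(a : K)) v - v * taylor (-(j : K)) f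

theorem skewBracket_eq (a : ℤ) (f : K[X]) (j : ℤ) (v : K[X]) :
    skewBracket a f j v = f * (taylor (-(a : K)) v - v) - v * (taylor (-(j : K)) f - f) := by
  rw [skewBracket]; ring

theorem DegLE.skewBracket {f v : K[X]} {A e : ℤ} (hf : f.DegLE A) (hv : v.DegLE e) (a j : ℤ) :
    (skewBracket a f j v).DegLE (A + e - 1) := by
  rw [skewBracket_eq]
  refine DegLE.sub ?_ ?_
  · exact (hf.mul (hv.taylor_sub _)).mono (by lia)
  · exact (hv.mul (hf.taylor_sub _)).mono (by lia)

/-- To leading order, a shift by `c` minus the identity is `c d/dX`, so the commutator becomes a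
Poisson bracket. -/
theorem DegLE.zcoeff_skewBracket {f v : K[X]} {A e : ℤ} (hf : f.DegLE A) (hv : v.DegLE e)
    (a j : ℤ) : (Polynomial.skewBracket a f j v).zcoeff (A + e - 1) =
      ((j * A - a * e : ℤ) : K) * f.zcoeff A * v.zcoeff e := by
  rw [skewBracket_eq, zcoeff_sub, show A + e - 1 = A + (e - 1) by ring,
    hf.zcoeff_mul (hv.taylor_sub _), show A + (e - 1) = e + (A - 1) by ring,
    hv.zcoeff_mul (hf.taylor_sub _), hf.zcoeff_taylor_sub, hv.zcoeff_taylor_sub]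
  push_cast
  ring

end Polynomial

end Degree

/-! ### The skew Laurent polynomial ring and its coefficients. -/

section SkewLaurent

variable {K : Type*} [Field K]

/-- The additive group of integers acts on polynomials by translations of the variable. -/
noncomputable instance translationAction : MulSemiringAction (Multiplicative ℤ) K[X] where
  smul n f := taylor (-(n.toAdd : K)) f
  one_smul f := by
    change taylor (-(((1 : Multiplicative ℤ).toAdd : ℤ) : K)) f = f
    simp
  mul_smul m n f := by
    change taylor _ f = taylor _ (taylor _ f)
    rw [taylor_taylor, toAdd_mul]
    congr 2
    push_cast
    ring
  smul_zero n := map_zero _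
  smul_add n := map_add _
  smul_one n := by
    change taylor _ 1 = 1
    simp
  smul_mul n := taylor_mul _

theorem translationAction_smul (n : ℤ) (f : K[X]) :
    Multiplicative.ofAdd n • f = taylor (-(n : K)) f := rfl

instance : SMulCommClass (Multiplicative ℤ) K K[X] where
  smul_comm n c f := map_smul (taylor (-(n.toAdd : K))) c f

/-- Skew Laurent polynomials over `K[h]` in a variable `x` with `x h = (h - 1) x`. -/
abbrev SkewLaurent (K : Type*) [Field K] : Type _ := SkewMonoidAlgebra K[X] (Multiplicative ℤ)

namespace SkewLaurent

/-- The element `f x ^ k`. -/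
noncomputable def mono (k : ℤ) (f : K[X]) : SkewLaurent K :=
  SkewMonoidAlgebra.single (Multiplicative.ofAdd k) f

/-- The coefficient of `x ^ k`. -/
noncomputable def cf (w : SkewLaurent K) (k : ℤ) : K[X] := w.coeff (Multiplicative.ofAdd k)

theorem ext_cf {u v : SkewLaurent K} (h : ∀ k, cf u k = cf v k) : u = v :=
  SkewMonoidAlgebra.ext h

@[simp] theorem cf_add (u v : SkewLaurent K) (k : ℤ) : cf (u + v) k = cf u k + cf v k := by
  simp [cf]

@[simp] theorem cf_sub (u v : SkewLaurent K) (k : ℤ) : cf (u - v) k = cf u k - cf v k := by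
  simp [cf]

@[simp] theorem cf_smul (c : K) (u : SkewLaurent K) (k : ℤ) : cf (c • u) k = c • cf u k := by
  simp [cf]

@[simp] theorem cf_zero (k : ℤ) : cf (0 : SkewLaurent K) k = 0 := by
  simp [cf]

theorem cf_one (k : ℤ) : cf (1 : SkewLaurent K) k = if k = 0 then 1 else 0 := by
  rw [cf, SkewMonoidAlgebra.coeff_one, Finsupp.single_apply]
  simp only [← ofAdd_zero, Multiplicative.ofAdd.injective.eq_iff, eq_comm]

theorem cf_mono (j : ℤ) (f : K[X]) (k : ℤ) : cf (mono j f) k = if k = j then f else 0 := by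
  rw [cf, mono, SkewMonoidAlgebra.coeff_single, Finsupp.single_apply]
  simp [eq_comm]

theorem cf_mono_mul (a : ℤ) (f : K[X]) (w : SkewLaurent K) (k : ℤ) :
    cf (mono a f * w) k = f * taylor (-(a : K)) (cf w (k - a)) := by
  rw [cf, mono, SkewMonoidAlgebra.coeff_single_mul, translationAction_smul, cf,
    sub_eq_neg_add]
  rfl

theorem cf_mul_mono (a : ℤ) (f : K[X]) (w : SkewLaurent K) (k : ℤ) :
    cf (w * mono a f) k = cf w (k - a) * taylor (-((k - a : ℤ) : K)) f := by
  rw [cf, mono, SkewMonoidAlgebra.coeff_mul_single]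
  rfl

theorem mono_mul_mono (a b : ℤ) (f g : K[X]) :
    mono a f * mono b g = mono (a + b) (f * taylor (-(a : K)) g) := by
  rw [mono, mono, SkewMonoidAlgebra.single_mul_single]; rfl

theorem mono_add (a : ℤ) (f g : K[X]) : mono a (f + g) = mono a f + mono a g :=
  SkewMonoidAlgebra.single_add _ _ _

@[simp] theorem mono_zero (a : ℤ) : mono a (0 : K[X]) = 0 :=
  SkewMonoidAlgebra.single_zero _

theorem mono_smul (a : ℤ) (c : K) (f : K[X]) : mono a (c • f) = c • mono a f :=
  (SkewMonoidAlgebra.smul_single _ _ _).symm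

theorem mono_zero_one : mono 0 (1 : K[X]) = 1 := rfl

theorem cf_commutator (a b : ℤ) (f g : K[X]) (w : SkewLaurent K) (k : ℤ) :
    cf ((mono a f + mono b g) * w - w * (mono a f + mono b g)) k =
      skewBracket a f (k - a) (cf w (k - a)) + skewBracket b g (k - b) (cf w (k - b)) := by
  rw [add_mul, mul_add, cf_sub, cf_add, cf_add, cf_mono_mul, cf_mono_mul, cf_mul_mono,
    cf_mul_mono, skewBracket, skewBracket]
  ring

theorem exists_cf_bound (w : SkewLaurent K) : ∃ M : ℕ, ∀ k : ℤ, cf w k ≠ 0 →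
    |k| ≤ M ∧ (cf w k).natDegree ≤ M := by
  refine SkewMonoidAlgebra.induction_on w ⟨0, by simp⟩ ?_ ?_
  · intro a f
    refine ⟨max a.toAdd.natAbs f.natDegree, fun k hk => ?_⟩
    change cf (mono a.toAdd f) k ≠ 0 at hk
    change _ ∧ (cf (mono a.toAdd f) k).natDegree ≤ _
    rw [cf_mono] at hk ⊢
    split_ifs at hk ⊢ with h
    · subst h
      refine ⟨?_, le_max_right _ _⟩
      rw [Int.abs_eq_natAbs]
      exact_mod_cast le_max_left _ _
    · exact absurd rfl hk
  · rintro u v ⟨M, hM⟩ ⟨N, hN⟩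
    refine ⟨max M N, fun k hk => ?_⟩
    have hu : (cf u k).natDegree ≤ max M N := by
      by_cases h : cf u k = 0
      · simp [h]
      · exact (hM k h).2.trans (le_max_left _ _)
    have hv : (cf v k).natDegree ≤ max M N := by
      by_cases h : cf v k = 0
      · simp [h]
      · exact (hN k h).2.trans (le_max_right _ _)
    rw [cf_add] at hk ⊢
    refine ⟨?_, natDegree_add_le_of_degree_le hu hv⟩
    by_cases h : cf u k = 0
    · have h' : cf v k ≠ 0 := fun h' => hk (by rw [h, h', add_zero])
      exact (hN k h').1.trans (by exact_mod_cast le_max_right _ _)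
    · exact (hM k h).1.trans (by exact_mod_cast le_max_left _ _)

end SkewLaurent

end SkewLaurent

/-! ### Ends of a finite support. -/

section Extremes

theorem exists_extreme_ne_zero {K : Type*} [Zero K] (c : ℤ → K) (M : ℕ)
    (hM : ∀ n, c n ≠ 0 → |n| ≤ M) {m : ℤ} (hm : c m ≠ 0) :
    ∃ a b : ℤ, a ≤ b ∧ c a ≠ 0 ∧ c b ≠ 0 ∧ (∀ n < a, c n = 0) ∧ ∀ n, b < n → c n = 0 := by
  obtain ⟨a, ha, ha'⟩ := Int.exists_least_of_bdd (P := fun n => c n ≠ 0)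
    ⟨-M, fun n hn => (abs_le.1 (hM n hn)).1⟩ ⟨m, hm⟩
  obtain ⟨b, hb, hb'⟩ := Int.exists_greatest_of_bdd (P := fun n => c n ≠ 0)
    ⟨M, fun n hn => (abs_le.1 (hM n hn)).2⟩ ⟨m, hm⟩
  refine ⟨a, b, ha' b hb, ha, hb, fun n hn => ?_, fun n hn => ?_⟩
  · by_contra h
    exact absurd (ha' n h) (not_le.2 hn)
  · by_contra h
    exact absurd (hb' n h) (not_le.2 hn)

end Extremes

/-! ### Degrees of opposite sign: leading forms for a weight. -/

namespace SkewLaurent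

variable {K : Type*} [Field K]

section Binomial

variable (r s : ℤ) (f g : K[X])

/-- The element `f x ^ (-r) + g x ^ s`. -/
noncomputable def binomial : SkewLaurent K := mono (-r) f + mono s g

/-- The weight of `f x ^ (-r) + g x ^ s` for the weights `r + s` of `h` and
`deg f - deg g` of `x`. -/
noncomputable def binomialWeight : ℤ := s * f.natDegree + r * g.natDegree

/-- The components of `u` of degrees congruent to `r` modulo `r + s` have bounded weight; the bound
is normalised by the integer `E`. -/
def WeightLE (u : SkewLaurent K) (E : ℤ) : Prop :=
  ∀ n : ℤ, (cf u (r + (r + s) * n)).DegLE (E - f.natDegree - (f.natDegree - g.natDegree) * n)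

/-- The coefficients of the weight-`E` part of `u`, see `WeightLE`. -/
noncomputable def leadingForm (u : SkewLaurent K) (E n : ℤ) : K :=
  (cf u (r + (r + s) * n)).zcoeff (E - f.natDegree - (f.natDegree - g.natDegree) * n)

variable {r s f g}

theorem WeightLE.mono {u : SkewLaurent K} {E E' : ℤ} (h : WeightLE r s f g u E) (hE : E ≤ E') :
    WeightLE r s f g u E' :=
  fun n => (h n).mono (by lia)

theorem exists_leadingForm_bound (hr : 0 < r) (hs : 0 < s) (u : SkewLaurent K) (E : ℤ) :
    ∃ M : ℕ, ∀ n, leadingForm r s f g u E n ≠ 0 → |n| ≤ M := by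
  obtain ⟨M, hM⟩ := exists_cf_bound u
  refine ⟨M + r.natAbs, fun n hn => ?_⟩
  have h0 : cf u (r + (r + s) * n) ≠ 0 := fun h => hn (by rw [leadingForm, h, zcoeff_zero])
  have h1 := (hM _ h0).1
  rw [abs_le] at h1 ⊢
  push_cast
  rw [abs_of_pos hr]
  constructor <;> nlinarith

theorem exists_weightLE (hr : 0 < r) (hs : 0 < s) (u : SkewLaurent K) :
    ∃ E : ℕ, WeightLE r s f g u E := by
  obtain ⟨M, hM⟩ := exists_cf_bound u
  refine ⟨f.natDegree + M + (f.natDegree + g.natDegree) * (M + r.natAbs), fun n => ?_⟩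
  by_cases h0 : cf u (r + (r + s) * n) = 0
  · rw [h0]; exact degLE_zero _
  obtain ⟨h1, h2⟩ := hM _ h0
  refine (degLE_natDegree _).mono ?_
  have h3 : |n| ≤ M + r := by
    rw [abs_le] at h1 ⊢
    constructor <;> nlinarith
  push_cast
  rw [abs_of_pos hr]
  have h4 : ((f.natDegree : ℤ) - g.natDegree) * n ≤ (f.natDegree + g.natDegree) * (M + r) := by
    refine (le_abs_self _).trans ?_
    rw [abs_mul]
    refine mul_le_mul ?_ h3 (abs_nonneg _) (by positivity)
    rw [abs_le]
    constructor <;> lia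
  have h5 : ((cf u (r + (r + s) * n)).natDegree : ℤ) ≤ M := by exact_mod_cast h2
  linarith

/-- Bound `E` means weight at most `(r + s) E - N`. Multiplying by the binomial adds `N` and the
commutator loses one power of `h`, so the bracket has weight at most `(r + s)(E - 1)`; `E = 1` is
the level of the constant `1`. Degree `(r + s) n` receives only the components with indices `n` and
`n - 1`. -/
theorem zcoeff_commutator_binomial {u : SkewLaurent K} {E : ℤ} (hu : WeightLE r s f g u E) (n : ℤ) :
    (cf (binomial r s f g * u - u * binomial r s f g) ((r + s) * n)).zcoeff
        (E - 1 - (f.natDegree - g.natDegree) * n) =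
      ((r * E + n * binomialWeight r s f g : ℤ) : K) * f.leadingCoeff * leadingForm r s f g u E n +
      ((n * binomialWeight r s f g - s * E : ℤ) : K) * g.leadingCoeff *
        leadingForm r s f g u E (n - 1) := by
  rw [binomial, cf_commutator, zcoeff_add,
    show (r + s) * n - -r = r + (r + s) * n by ring,
    show (r + s) * n - s = r + (r + s) * (n - 1) by ring]
  have h1 := (degLE_natDegree f).zcoeff_skewBracket (hu n) (-r) (r + (r + s) * n)
  have h2 := (degLE_natDegree g).zcoeff_skewBracket (hu (n - 1)) s (r + (r + s) * (n - 1))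
  rw [show (f.natDegree : ℤ) + (E - f.natDegree - (f.natDegree - g.natDegree) * n) - 1 =
    E - 1 - (f.natDegree - g.natDegree) * n by ring] at h1
  rw [show (g.natDegree : ℤ) + (E - f.natDegree - (f.natDegree - g.natDegree) * (n - 1)) - 1 =
    E - 1 - (f.natDegree - g.natDegree) * n by ring] at h2
  rw [h1, h2, zcoeff_natCast, zcoeff_natCast, leadingForm, leadingForm, binomialWeight]
  simp only [coeff_natDegree]
  push_cast
  ring

theorem leadingForm_recursion (hr : 0 < r) (hs : 0 < s) {u : SkewLaurent K} {E : ℤ}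
    (hu : WeightLE r s f g u E) (h : binomial r s f g * u - u * binomial r s f g = 1) (n : ℤ) :
      ((r * E + n * binomialWeight r s f g : ℤ) : K) * f.leadingCoeff * leadingForm r s f g u E n +
      ((n * binomialWeight r s f g - s * E : ℤ) : K) * g.leadingCoeff *
        leadingForm r s f g u E (n - 1) = if n = 0 ∧ E = 1 then 1 else 0 := by
  rw [← zcoeff_commutator_binomial hu, h, cf_one]
  have hd : r + s ≠ 0 := by lia
  by_cases hn : n = 0
  · subst hn
    simp [zcoeff_one, sub_eq_zero]
  · simp [hn, hd]

theorem cf_binomial_mul (u : SkewLaurent K) (k : ℤ) :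
    cf (binomial r s f g * u) k =
      f * taylor (-((-r : ℤ) : K)) (cf u (k + r)) + g * taylor (-(s : K)) (cf u (k - s)) := by
  rw [binomial, add_mul, cf_add, cf_mono_mul, cf_mono_mul, sub_neg_eq_add]

/-- The `j`-th power has weight at most `j N`; the hypothesis says that `h^(m+1) x^k` is already
heavier. -/
theorem degLE_cf_binomial_pow (hr : 0 < r) (hs : 0 < s) (j : ℕ) (k m : ℤ)
    (h : j * binomialWeight r s f g <
      (r + s) * (m + 1) + ((f.natDegree : ℤ) - g.natDegree) * k) :
    (cf (binomial r s f g ^ j) k).DegLE m := by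
  induction j generalizing k m with
  | zero =>
    rw [pow_zero, cf_one]
    split_ifs with hk
    · subst hk
      have : 0 ≤ m := by
        by_contra hm
        have : (r + s) * (m + 1) ≤ 0 := mul_nonpos_of_nonneg_of_nonpos (by lia) (by lia)
        simp at h
        lia
      refine (degLE_natDegree _).mono (by simpa using this)
    · exact degLE_zero _
  | succ j ih =>
    rw [pow_succ', cf_binomial_mul]
    rw [binomialWeight] at ih h
    push_cast at h
    refine DegLE.add ?_ ?_
    · refine ((degLE_natDegree f).mul ((ih (k + r) (m - f.natDegree) ?_).taylor _)).mono (by lia)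
      linarith
    · refine ((degLE_natDegree g).mul ((ih (k - s) (m - g.natDegree) ?_).taylor _)).mono (by lia)
      linarith

theorem cf_binomial_pow_of_lt (hr : 0 < r) (hs : 0 < s) (j : ℕ) (k : ℤ) (h : k < -(r * j)) :
    cf (binomial r s f g ^ j) k = 0 := by
  induction j generalizing k with
  | zero =>
    rw [pow_zero, cf_one, if_neg]
    simp at h
    lia
  | succ j ih =>
    push_cast at h
    rw [pow_succ', cf_binomial_mul, ih _ (by linarith), ih _ (by linarith)]
    simp

/-- The lowest component of the power is `(f x^(-r))^j`, since every other product involves `x^s`.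
-/
theorem zcoeff_cf_binomial_pow (hr : 0 < r) (hs : 0 < s) (j : ℕ) :
    (cf (binomial r s f g ^ j) (-(r * j))).zcoeff (j * f.natDegree) = f.leadingCoeff ^ j := by
  induction j with
  | zero => simp [cf_one, zcoeff_one]
  | succ j ih =>
    have hd : (cf (binomial r s f g ^ j) (-(r * j))).DegLE (j * f.natDegree) := by
      refine degLE_cf_binomial_pow hr hs _ _ _ ?_
      rw [binomialWeight]
      linarith
    rw [pow_succ', cf_binomial_mul,
      cf_binomial_pow_of_lt hr hs j (-(r * (j + 1 : ℕ)) - s) (by push_cast; linarith),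
      show -(r * ((j + 1 : ℕ) : ℤ)) + r = -(r * j) by push_cast; ring, map_zero, mul_zero, add_zero,
      show (((j + 1 : ℕ) : ℤ) * f.natDegree) = f.natDegree + j * f.natDegree by push_cast; ring,
      (degLE_natDegree f).zcoeff_mul (hd.taylor _), hd.zcoeff_taylor, ih, zcoeff_natCast,
      coeff_natDegree, pow_succ']

/-- For `E ≥ 2` the recursion is homogeneous, so a nonzero solution of finite support can only start
at `n = -r E / N`. Cancelling that one coefficient with a multiple of a power of the binomial, which
commutes with it, kills the whole leading form. -/
theorem exists_weightLE_pred [CharZero K] (hr : 0 < r) (hs : 0 < s) (hf : f ≠ 0) (hg : g ≠ 0)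
    (hrf : r ≤ f.natDegree) {w : SkewLaurent K} {E : ℤ} (hE : 2 ≤ E) (hw : WeightLE r s f g w E)
    (h : binomial r s f g * w - w * binomial r s f g = 1) :
    ∃ w' : SkewLaurent K, binomial r s f g * w' - w' * binomial r s f g = 1 ∧
      WeightLE r s f g w' (E - 1) := by
  have hf' := leadingCoeff_ne_zero.2 hf
  have hg' := leadingCoeff_ne_zero.2 hg
  have hN : binomialWeight r s f g = s * f.natDegree + r * g.natDegree := rfl
  have hN0 : 0 < binomialWeight r s f g := by
    rw [hN]
    have : 0 < s * (f.natDegree : ℤ) := mul_pos hs (by lia)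
    positivity
  set N := binomialWeight r s f g
  have hrec (u : SkewLaurent K) (hu : WeightLE r s f g u E)
      (h : binomial r s f g * u - u * binomial r s f g = 1) (n : ℤ) :=
    (leadingForm_recursion hr hs hu h n).trans (if_neg (by lia))
  have lowest (u : SkewLaurent K) (hu : WeightLE r s f g u E)
      (h : binomial r s f g * u - u * binomial r s f g = 1) (n : ℤ)
      (hn : leadingForm r s f g u E n ≠ 0) (hn' : leadingForm r s f g u E (n - 1) = 0) :
      r * E + n * N = 0 := by
    have := hrec u hu h n
    rw [hn', mul_zero, add_zero, mul_eq_zero, mul_eq_zero, or_iff_left hn, or_iff_left hf'] at this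
    exact_mod_cast this
  by_cases hc : ∀ n, leadingForm r s f g w E n = 0
  · refine ⟨w, h, fun n => ?_⟩
    exact ((hw n).pred (hc n)).mono (by lia)
  push Not at hc
  obtain ⟨m, hm⟩ := hc
  obtain ⟨M, hM⟩ := exists_leadingForm_bound (f := f) (g := g) hr hs w E
  obtain ⟨a, b, hab, ha, hb, ha', hb'⟩ := exists_extreme_ne_zero _ M hM hm
  have hlow := lowest w hw h a ha (ha' _ (by lia))
  -- Just above the support only the second term of the recursion survives.
  have hhigh : (b + 1) * N - s * E = 0 := by
    have := hrec w hw h (b + 1)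
    rw [hb' (b + 1) (by lia), mul_zero, zero_add, add_sub_cancel_right, mul_eq_zero, mul_eq_zero,
      or_iff_left hb, or_iff_left hg'] at this
    exact_mod_cast this
  obtain ⟨j, hj⟩ := Int.eq_ofNat_of_zero_le (sub_nonneg.2 hab)
  have hjE : (r + s) * E = (j + 1) * N := by rw [← hj]; linarith
  -- Index `a` thus sits at the lowest term of the `j`-th power: `x`-degree `-r j` and, by `hdeg`,
  -- `h`-degree `j deg f`.
  have hja : r + (r + s) * a = -(r * j) := by
    have : N * (r + (r + s) * a + r * j) = 0 := by
      rw [← hj]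
      linear_combination (r + s) * hlow - r * (hlow - hhigh)
    have := (mul_eq_zero.1 this).resolve_left hN0.ne'
    lia
  have hdeg : E - f.natDegree - (f.natDegree - g.natDegree) * a = j * f.natDegree := by
    have : (r + s) * (E - f.natDegree - (f.natDegree - g.natDegree) * a) =
        (r + s) * (j * f.natDegree) := by
      linear_combination hjE - ((f.natDegree : ℤ) - g.natDegree) * hja + (j + 1) * hN
    exact mul_left_cancel₀ (by lia) this
  have hpow : WeightLE r s f g (binomial r s f g ^ j) E := by
    intro n
    refine degLE_cf_binomial_pow hr hs _ _ _ ?_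
    change j * N < _
    linarith
  set c : K := leadingForm r s f g w E a / f.leadingCoeff ^ j with hcdef
  have hw' : WeightLE r s f g (w - c • binomial r s f g ^ j) E := by
    intro n
    rw [cf_sub, cf_smul]
    exact (hw n).sub ((hpow n).smul c)
  have hcomm : binomial r s f g * (w - c • binomial r s f g ^ j) -
      (w - c • binomial r s f g ^ j) * binomial r s f g = 1 := by
    rw [mul_sub, sub_mul, mul_smul_comm, smul_mul_assoc, ← pow_succ, ← pow_succ',
      sub_sub_sub_cancel_right, h]
  refine ⟨_, hcomm, fun n => ?_⟩
  refine ((hw' n).pred ?_).mono (by lia)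
  have hzero : leadingForm r s f g (w - c • binomial r s f g ^ j) E a = 0 := by
    have : leadingForm r s f g w E a = c * f.leadingCoeff ^ j := by
      rw [hcdef, div_mul_cancel₀ _ (pow_ne_zero _ hf')]
    rw [leadingForm, cf_sub, cf_smul, zcoeff_sub, zcoeff_smul, ← leadingForm, this, hja, hdeg,
      zcoeff_cf_binomial_pow hr hs, sub_self]
  by_contra hn
  obtain ⟨M', hM'⟩ := exists_leadingForm_bound (f := f) (g := g) hr hs
    (w - c • binomial r s f g ^ j) E
  obtain ⟨a', b', -, hna', -, hz', -⟩ := exists_extreme_ne_zero _ M' hM' hn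
  have := lowest _ hw' hcomm a' hna' (hz' _ (by lia))
  have haa : a' = a := by
    have : (a' - a) * N = 0 := by linarith
    have := (mul_eq_zero.1 this).resolve_right hN0.ne'
    lia
  exact hna' (haa ▸ hzero)

/-- The ends of the support bound `N = s deg f + r deg g` by `s` or by `r`, while `deg f ≥ r` gives
`N ≥ s r`. -/
theorem natDegree_eq_of_weightLE_one [CharZero K] (hr : 0 < r) (hs : 0 < s) (hf : f ≠ 0)
    (hg : g ≠ 0) (hrf : r ≤ f.natDegree) {w : SkewLaurent K} (hw : WeightLE r s f g w 1)
    (h : binomial r s f g * w - w * binomial r s f g = 1) :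
    f.natDegree = r ∧ g.natDegree = 0 ∧ (r = 1 ∨ s = 1) := by
  have hf' := leadingCoeff_ne_zero.2 hf
  have hg' := leadingCoeff_ne_zero.2 hg
  have hN : binomialWeight r s f g = s * f.natDegree + r * g.natDegree := rfl
  have hrec (n : ℤ) := leadingForm_recursion hr hs hw h n
  simp only [and_true, mul_one] at hrec
  have hc : ∃ m, leadingForm r s f g w 1 m ≠ 0 := by
    by_contra! hc
    have := hrec 0
    simp [hc] at this
  obtain ⟨m, hm⟩ := hc
  obtain ⟨M, hM⟩ := exists_leadingForm_bound (f := f) (g := g) hr hs w 1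
  obtain ⟨a, b, hab, ha, hb, ha', hb'⟩ := exists_extreme_ne_zero _ M hM hm
  have hN1 : s * r ≤ s * f.natDegree := mul_le_mul_of_nonneg_left hrf hs.le
  have hN2 : 0 ≤ r * (g.natDegree : ℤ) := by positivity
  have hN3 : 0 < s * r := mul_pos hs hr
  have key : f.natDegree = r ∧ (g.natDegree : ℤ) = 0 ∧ (r = 1 ∨ s = 1) := by
    -- Only the equation `n = 0` is inhomogeneous. If the support starts at `0`, use the equation `n
    -- = b + 1`; otherwise use `n = a`.
    by_cases ha0 : a = 0
    · have := hrec (b + 1)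
      rw [hb' (b + 1) (by lia), mul_zero, zero_add, add_sub_cancel_right, if_neg (by lia), mul_eq_zero,
        mul_eq_zero, or_iff_left hb, or_iff_left hg'] at this
      have hle : (b + 1) * binomialWeight r s f g - s = 0 := by exact_mod_cast this
      have hle' : s * f.natDegree + r * g.natDegree ≤ s := by
        rw [← hN]
        nlinarith
      have hf1 : (f.natDegree : ℤ) ≤ 1 := by nlinarith
      have hg0 : (g.natDegree : ℤ) ≤ 0 := by nlinarith
      exact ⟨by lia, by lia, by lia⟩
    · have := hrec a
      rw [ha' (a - 1) (by lia), mul_zero, add_zero, if_neg ha0, mul_eq_zero,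
        mul_eq_zero, or_iff_left ha, or_iff_left hf'] at this
      have hle : r + a * binomialWeight r s f g = 0 := by exact_mod_cast this
      have hle' : s * f.natDegree + r * g.natDegree ≤ r := by
        rw [← hN]
        have : a < 0 := by
          by_contra hcon
          nlinarith
        nlinarith
      have hs1 : s ≤ 1 := by nlinarith
      have hs2 : s = 1 := by lia
      subst hs2
      have hg0 : (g.natDegree : ℤ) ≤ 0 := by nlinarith
      exact ⟨by lia, by lia, by lia⟩
  exact ⟨key.1, by exact_mod_cast key.2.1, key.2.2⟩

theorem natDegree_eq_of_binomial_commutator [CharZero K] (hr : 0 < r) (hs : 0 < s) (hf : f ≠ 0)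
    (hg : g ≠ 0) (hrf : r ≤ f.natDegree) {w : SkewLaurent K}
    (h : binomial r s f g * w - w * binomial r s f g = 1) :
    f.natDegree = r ∧ g.natDegree = 0 ∧ (r = 1 ∨ s = 1) := by
  obtain ⟨E, hE⟩ := exists_weightLE (f := f) (g := g) hr hs w
  induction E generalizing w with
  | zero => exact natDegree_eq_of_weightLE_one hr hs hf hg hrf (hE.mono (by simp)) h
  | succ E ih =>
    rcases E with _ | E
    · exact natDegree_eq_of_weightLE_one hr hs hf hg hrf (by simpa using hE) h
    · obtain ⟨w', hw', hE'⟩ := exists_weightLE_pred hr hs hf hg hrf (by push_cast; lia) hE h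
      exact ih hw' (by simpa using hE')

end Binomial

end SkewLaurent

/-! ### Nonnegative degrees: lowest components. -/

namespace SkewLaurent

variable {K : Type*} [Field K]

theorem skewBracket_zero_right (a : ℤ) (f : K[X]) (j : ℤ) : skewBracket a f j 0 = 0 := by
  simp [skewBracket]

theorem exists_lowest_cf {w : SkewLaurent K} (hw : w ≠ 0) :
    ∃ m, cf w m ≠ 0 ∧ ∀ n < m, cf w n = 0 := by
  obtain ⟨M, hM⟩ := exists_cf_bound w
  have : ∃ k, cf w k ≠ 0 := by
    by_contra! h
    exact hw (ext_cf fun k => by rw [h, cf_zero])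
  obtain ⟨k, hk⟩ := this
  obtain ⟨a, -, -, ha, -, ha', -⟩ := exists_extreme_ne_zero (cf w) M (fun n hn => (hM n hn).1) hk
  exact ⟨a, ha, ha'⟩

theorem skewBracket_lowest {a b : ℤ} (hab : a < b) {f g : K[X]} {w : SkewLaurent K}
    (h : (mono a f + mono b g) * w - w * (mono a f + mono b g) = 1) {m : ℤ}
    (hm : ∀ n < m, cf w n = 0) : skewBracket a f m (cf w m) = if m + a = 0 then 1 else 0 := by
  have := congrArg (cf · (m + a)) h
  simp only [cf_commutator, cf_one] at this
  rwa [hm (m + a - b) (by lia), skewBracket_zero_right, add_zero, add_sub_cancel_right] at this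

/-- A nonconstant `f` commutes with the lowest component of `w` only in degree `0`, but there the
commutator must be `1`. -/
theorem natDegree_eq_zero_of_commutator [CharZero K] {b : ℤ} (hb : 0 < b) {f g : K[X]}
    {w : SkewLaurent K} (h : (mono 0 f + mono b g) * w - w * (mono 0 f + mono b g) = 1) :
    f.natDegree = 0 := by
  by_contra hA
  have hf : f ≠ 0 := by rintro rfl; simp at hA
  obtain ⟨m, hm, hm'⟩ := exists_lowest_cf (w := w) (by rintro rfl; simp at h)
  have h1 := skewBracket_lowest hb h hm'
  rw [add_zero] at h1
  by_cases h0 : m = 0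
  · subst h0
    simp [skewBracket, mul_comm] at h1
  · have h2 := (degLE_natDegree f).zcoeff_skewBracket (degLE_natDegree (cf w m)) 0 m
    rw [h1, if_neg h0, zcoeff_zero, zcoeff_natCast, zcoeff_natCast, coeff_natDegree,
      coeff_natDegree, eq_comm, mul_eq_zero, mul_eq_zero, or_iff_left (leadingCoeff_ne_zero.2 hm),
      or_iff_left (leadingCoeff_ne_zero.2 hf)] at h2
    norm_cast at h2
    simp [h0, hA] at h2

/-- The lowest degree `m` of `w` is negative, as `1` must arise in degree `0`. Then `m deg f - a deg
w_m < 0`, so the lowest bracket is nonzero and must itself be the `1`; comparing degrees in `h`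
settles the rest. -/
theorem lowest_of_commutator [CharZero K] {a b : ℤ} (ha : 0 < a) (hab : a < b) {f g : K[X]}
    (hf : f ≠ 0) {w : SkewLaurent K} (hw : ∀ k < 0, cf w k ≠ 0 → -k ≤ (cf w k).natDegree)
    (h : (mono a f + mono b g) * w - w * (mono a f + mono b g) = 1) :
    a = 1 ∧ f.natDegree = 0 ∧ cf w (-1) ≠ 0 ∧ (cf w (-1)).natDegree = 1 := by
  obtain ⟨m, hm, hm'⟩ := exists_lowest_cf (w := w) (by rintro rfl; simp at h)
  have h1 := skewBracket_lowest hab h hm'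
  rcases lt_or_ge m 0 with h0 | h0
  · have hdeg := hw m h0 hm
    have h2 := (degLE_natDegree f).zcoeff_skewBracket (degLE_natDegree (cf w m)) a m
    rw [h1, zcoeff_natCast, zcoeff_natCast, coeff_natDegree, coeff_natDegree] at h2
    have h3 : m * (f.natDegree : ℤ) - a * (cf w m).natDegree ≠ 0 := by
      have : m * (f.natDegree : ℤ) ≤ 0 := mul_nonpos_of_nonpos_of_nonneg h0.le (by lia)
      have : 0 < a * ((cf w m).natDegree : ℤ) := mul_pos ha (by lia)
      lia
    have h4 := mul_ne_zero (mul_ne_zero (Int.cast_ne_zero (α := K).2 h3)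
      (leadingCoeff_ne_zero.2 hf)) (leadingCoeff_ne_zero.2 hm)
    rw [← h2] at h4
    by_cases h5 : m + a = 0
    · rw [if_pos h5, zcoeff_one] at h4
      have h6 : (f.natDegree : ℤ) + (cf w m).natDegree - 1 = 0 := by
        by_contra h6
        exact h4 (if_neg h6)
      have h7 : m = -1 := by lia
      subst h7
      exact ⟨by lia, by lia, hm, by lia⟩
    · rw [if_neg h5] at h4
      simp at h4
  · have h2 := congrArg (cf · 0) h
    simp only [cf_commutator, cf_one] at h2
    rw [hm' (0 - a) (by lia), hm' (0 - b) (by lia), skewBracket_zero_right,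
      skewBracket_zero_right] at h2
    simp at h2

/-- If `g ≠ 0`, each nonzero bracket with `g x^b` must be cancelled by a bracket of `f x` with a
component `b - 1` degrees higher, so `w` would have infinite support. -/
theorem eq_zero_of_commutator [CharZero K] {b : ℤ} (hb : 1 < b) {f g : K[X]} (hf : f ≠ 0)
    (hf0 : f.natDegree = 0) {w : SkewLaurent K} (h1 : cf w (-1) ≠ 0)
    (h1' : (cf w (-1)).natDegree = 1)
    (h : (mono 1 f + mono b g) * w - w * (mono 1 f + mono b g) = 1) : g = 0 := by
  by_contra hg
  have key (k : ℕ) : cf w (-1 + (b - 1) * k) ≠ 0 ∧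
      (cf w (-1 + (b - 1) * k)).natDegree = 1 + k * g.natDegree := by
    induction k with
    | zero => simp [h1, h1']
    | succ k ih =>
      obtain ⟨ih1, ih2⟩ := ih
      set v := cf w (-1 + (b - 1) * k) with hv
      set v' := cf w (-1 + (b - 1) * (k + 1 : ℕ)) with hv'
      have h2 := congrArg (cf · ((b - 1) * (k + 1 : ℕ))) h
      simp only [cf_commutator, cf_one] at h2
      rw [if_neg (mul_ne_zero (by lia) (by lia)), sub_eq_neg_add, ← hv',
        show (b - 1) * ((k + 1 : ℕ) : ℤ) - b = -1 + (b - 1) * k by push_cast; ring, ← hv] at h2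
      have h3 := (degLE_natDegree g).zcoeff_skewBracket (degLE_natDegree v) b (-1 + (b - 1) * k)
      have h3' := (degLE_natDegree g).skewBracket (degLE_natDegree v) b (-1 + (b - 1) * k)
      have h4 := (degLE_natDegree f).zcoeff_skewBracket (degLE_natDegree v') 1
        (-1 + (b - 1) * (k + 1 : ℕ))
      have h4' := (degLE_natDegree f).skewBracket (degLE_natDegree v') 1
        (-1 + (b - 1) * (k + 1 : ℕ))
      rw [eq_neg_of_add_eq_zero_right h2, ih2] at h3 h3'
      rw [hf0, zcoeff_natCast, zcoeff_natCast] at h4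
      rw [zcoeff_natCast, zcoeff_natCast, coeff_natDegree, ← ih2, coeff_natDegree, ih2] at h3
      rw [hf0] at h4'
      -- The value is `-(k + 1) deg g - b`.
      have h5 : (-1 + (b - 1) * (k : ℤ)) * g.natDegree - b * (1 + k * g.natDegree : ℕ) ≠ 0 := by
        have : (0 : ℤ) ≤ k * g.natDegree := by positivity
        push_cast
        nlinarith
      have h6 := mul_ne_zero (mul_ne_zero (Int.cast_ne_zero (α := K).2 h5)
        (leadingCoeff_ne_zero.2 hg)) (leadingCoeff_ne_zero.2 ih1)
      have hv0 : v' ≠ 0 := by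
        intro h0
        rw [h0, skewBracket_zero_right] at h3
        rw [← h3] at h6
        simp at h6
      refine ⟨hv0, ?_⟩
      rw [← h3, ← zero_sub, zcoeff_sub, zcoeff_zero, zero_sub, neg_ne_zero,
        show (g.natDegree : ℤ) + ((1 + k * g.natDegree : ℕ) : ℤ) - 1 = ((k + 1) * g.natDegree : ℕ) by
          push_cast; ring, zcoeff_natCast] at h6
      have h7 : ¬ ((0 : ℕ) : ℤ) + v'.natDegree - 1 < ((k + 1) * g.natDegree : ℕ) :=
        fun h7 => h6 (h4' _ h7)
      -- Otherwise the top coefficient of the bracket with the constant `f`, a nonzero multiple of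
      -- `deg v'`, would have to vanish.
      have h8 : ¬ (k + 1) * g.natDegree + 1 < v'.natDegree := by
        intro h8
        obtain ⟨i, hi⟩ := Nat.exists_eq_add_of_lt h8
        have h9 : ((0 : ℕ) : ℤ) + v'.natDegree - 1 = ((k + 1) * g.natDegree + i + 1 : ℕ) := by
          rw [hi]; push_cast; ring
        rw [h9, zcoeff_natCast] at h4
        have h10 := h3' ((k + 1) * g.natDegree + i + 1) (by push_cast; lia)
        rw [coeff_neg, neg_eq_zero] at h10
        rw [h10, ← hf0, coeff_natDegree, coeff_natDegree, eq_comm, mul_eq_zero, mul_eq_zero,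
          or_iff_left (leadingCoeff_ne_zero.2 hf), or_iff_left (leadingCoeff_ne_zero.2 hv0)] at h4
        norm_cast at h4
        rw [hf0] at h4
        simp at h4
        lia
      lia
  obtain ⟨M, hM⟩ := exists_cf_bound w
  have := (abs_le.1 (hM _ (key (M + 2)).1).1).2
  push_cast at this
  nlinarith

end SkewLaurent

/-! ### Generating pairs with commutator `1`. -/

section Slice

variable {K A : Type*} [Field K] [Ring A] [Algebra K A] {x y : A}

theorem mul_pow_eq_of_commutator_eq_one {R : Type*} [Ring R] {x y : R} (h : x * y - y * x = 1)
    (i : ℕ) : x * y ^ i = y ^ i * x + i * y ^ (i - 1) := by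
  have h' : x * y = y * x + 1 := sub_eq_iff_eq_add'.1 h
  induction i with
  | zero => simp
  | succ i ih =>
    rw [pow_succ', ← mul_assoc, h', add_mul, mul_assoc, ih, mul_add, one_mul, ← mul_assoc,
      Nat.add_sub_cancel]
    rcases i with _ | i
    · simp
    · rw [Nat.add_sub_cancel, ← mul_assoc y, (Nat.cast_commute (i + 1) y).symm.eq, mul_assoc _ y,
        ← pow_succ', add_assoc]
      push_cast
      simp only [add_mul, one_mul, ← pow_succ', add_assoc]

/-- The span contains `1` and is stable under left multiplication by `x` and `y`. -/
theorem span_pow_mul_eq_top (h : x * y - y * x = 1) (htop : Algebra.adjoin K {x, y} = ⊤) :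
    Submodule.span K {u : A | ∃ i : ℕ, ∃ c ∈ Algebra.adjoin K {x}, u = y ^ i * c} = ⊤ := by
  set S := Submodule.span K {u : A | ∃ i : ℕ, ∃ c ∈ Algebra.adjoin K {x}, u = y ^ i * c}
  have hx : x ∈ Algebra.adjoin K {x} := Algebra.subset_adjoin rfl
  have hxS : ∀ v ∈ S, x * v ∈ S := by
    intro v hv
    induction hv using Submodule.span_induction with
    | mem v hv =>
      obtain ⟨i, c, hc, rfl⟩ := hv
      rw [← mul_assoc, mul_pow_eq_of_commutator_eq_one h, add_mul, mul_assoc, mul_assoc,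
        ← nsmul_eq_mul]
      refine S.add_mem (Submodule.subset_span ⟨i, _, mul_mem hx hc, rfl⟩)
        (S.smul_of_tower_mem _ (Submodule.subset_span ⟨i - 1, c, hc, rfl⟩ : y ^ (i - 1) * c ∈ S))
    | zero => simp
    | add a b _ _ ha hb => rw [mul_add]; exact add_mem ha hb
    | smul c a _ ha => rw [mul_smul_comm]; exact S.smul_mem _ ha
  have hyS : ∀ v ∈ S, y * v ∈ S := by
    intro v hv
    induction hv using Submodule.span_induction with
    | mem v hv =>
      obtain ⟨i, c, hc, rfl⟩ := hv
      rw [← mul_assoc, ← pow_succ']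
      exact Submodule.subset_span ⟨_, c, hc, rfl⟩
    | zero => simp
    | add a b _ _ ha hb => rw [mul_add]; exact add_mem ha hb
    | smul c a _ ha => rw [mul_smul_comm]; exact S.smul_mem _ ha
  rw [Submodule.eq_top_iff']
  intro u
  have hu : u ∈ Algebra.adjoin K {x, y} := htop ▸ Algebra.mem_top
  have : ∀ v ∈ S, u * v ∈ S := by
    induction hu using Algebra.adjoin_induction with
    | mem u hu =>
      rcases hu with rfl | rfl
      · exact hxS
      · exact hyS
    | algebraMap c => intro v hv; rw [← Algebra.smul_def]; exact S.smul_mem _ hv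
    | add a b _ _ ha hb => intro v hv; rw [add_mul]; exact add_mem (ha v hv) (hb v hv)
    | mul a b _ _ ha hb => intro v hv; rw [mul_assoc]; exact ha _ (hb v hv)
  simpa using this 1 (Submodule.subset_span ⟨0, 1, one_mem _, by simp⟩)

theorem exists_eq_sum_pow_mul (h : x * y - y * x = 1) (htop : Algebra.adjoin K {x, y} = ⊤)
    (u : A) : ∃ (n : ℕ) (c : ℕ → A), (∀ i, c i ∈ Algebra.adjoin K {x}) ∧
      u = ∑ i ∈ Finset.range n, y ^ i * c i := by
  have hu := (span_pow_mul_eq_top h htop).symm ▸ Submodule.mem_top (x := u)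
  -- Vanishing beyond `n` lets sums of different lengths be added.
  suffices H : ∃ (n : ℕ) (c : ℕ → A), (∀ i, c i ∈ Algebra.adjoin K {x}) ∧
      (∀ i, n ≤ i → c i = 0) ∧ u = ∑ i ∈ Finset.range n, y ^ i * c i by
    obtain ⟨n, c, hc, -, hu⟩ := H
    exact ⟨n, c, hc, hu⟩
  induction hu using Submodule.span_induction with
  | mem u hu =>
    obtain ⟨i, c, hc, rfl⟩ := hu
    refine ⟨i + 1, Pi.single i c, fun j => ?_, fun j hj => ?_, ?_⟩
    · by_cases hj : j = i
      · subst hj; simpa using hc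
      · simp [hj]
    · exact Pi.single_eq_of_ne (by lia) _
    · rw [Finset.sum_range_succ, Finset.sum_eq_zero, Pi.single_eq_same, zero_add]
      intro j hj
      rw [Pi.single_eq_of_ne (Finset.mem_range.1 hj).ne, mul_zero]
  | zero => exact ⟨0, 0, fun _ => zero_mem _, fun _ _ => rfl, by simp⟩
  | add a b _ _ ha hb =>
    obtain ⟨n, c, hc, hc0, rfl⟩ := ha
    obtain ⟨m, d, hd, hd0, rfl⟩ := hb
    refine ⟨max n m, c + d, fun i => add_mem (hc i) (hd i), fun i hi => ?_, ?_⟩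
    · rw [Pi.add_apply, hc0 i (by lia), hd0 i (by lia), add_zero]
    · simp only [Pi.add_apply, mul_add, Finset.sum_add_distrib]
      congr 1
      · refine Finset.sum_subset (by simp) fun i _ hi => ?_
        rw [hc0 i (by simpa using hi), mul_zero]
      · refine Finset.sum_subset (by simp) fun i _ hi => ?_
        rw [hd0 i (by simpa using hi), mul_zero]
  | smul k a _ ha =>
    obtain ⟨n, c, hc, hc0, rfl⟩ := ha
    refine ⟨n, k • c, fun i => Subalgebra.smul_mem _ (hc i) k, fun i hi => ?_, ?_⟩
    · rw [Pi.smul_apply, hc0 i hi, smul_zero]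
    · simp [Finset.smul_sum]

theorem commute_of_mem_adjoin_singleton {c : A} (hc : c ∈ Algebra.adjoin K {x}) : Commute x c := by
  induction hc using Algebra.adjoin_induction with
  | mem u hu => rw [Set.mem_singleton_iff.1 hu]
  | algebraMap k => exact (Algebra.commutes k x).symm
  | add a b _ _ ha hb => exact ha.add_right hb
  | mul a b _ _ ha hb => exact ha.mul_right hb

variable (x) in
/-- The inner derivation `u ↦ x u - u x`. -/
def commutatorWith : AddMonoid.End A := (AddMonoidHom.mulLeft x - AddMonoidHom.mulRight x : A →+ A)

theorem commutatorWith_apply (u : A) : commutatorWith x u = x * u - u * x := rfl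

theorem commutatorWith_iterate (h : x * y - y * x = 1) {c : A} (hc : Commute x c) (i k : ℕ) :
    (commutatorWith x)^[k] (y ^ i * c) = i.descFactorial k • (y ^ (i - k) * c) := by
  induction k with
  | zero => simp
  | succ k ih =>
    rw [Function.iterate_succ_apply', ih, map_nsmul, commutatorWith_apply, ← mul_assoc,
      mul_pow_eq_of_commutator_eq_one h, add_mul, mul_assoc, hc.eq, mul_assoc _ c x,
      add_sub_cancel_left, mul_assoc, ← nsmul_eq_mul, smul_smul, Nat.descFactorial_succ,
      mul_comm (i - k), Nat.sub_sub]

/-- The bracket with `x` differentiates in `y`: applied as often as the top power of `y`, it leaves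
a factorial times the top coefficient, which is therefore zero. -/
theorem sum_mem_adjoin_of_commute [CharZero K] (h : x * y - y * x = 1) (n : ℕ) (c : ℕ → A)
    (hc : ∀ i, c i ∈ Algebra.adjoin K {x})
    (hu : Commute x (∑ i ∈ Finset.range (n + 1), y ^ i * c i)) :
    ∑ i ∈ Finset.range (n + 1), y ^ i * c i ∈ Algebra.adjoin K {x} := by
  induction n with
  | zero => simpa using hc 0
  | succ n ih =>
    suffices h0 : c (n + 1) = 0 by
      rw [Finset.sum_range_succ, h0, mul_zero, add_zero] at hu ⊢
      exact ih hu
    have h1 : (commutatorWith x)^[n + 1] (∑ i ∈ Finset.range (n + 1 + 1), y ^ i * c i) = 0 := by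
      rw [Function.iterate_succ_apply, commutatorWith_apply, sub_eq_zero.2 hu.eq]
      exact iterate_map_zero _ _
    rw [← AddMonoid.End.coe_pow, map_sum] at h1
    simp only [AddMonoid.End.coe_pow,
      commutatorWith_iterate h (commute_of_mem_adjoin_singleton (hc _))] at h1
    rw [Finset.sum_range_succ, Finset.sum_eq_zero, zero_add, Nat.sub_self, pow_zero, one_mul,
      Nat.descFactorial_self, ← Nat.cast_smul_eq_nsmul K] at h1
    · exact (smul_eq_zero.1 h1).resolve_left (Nat.cast_ne_zero.2 (Nat.factorial_ne_zero _))
    · intro i hi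
      rw [Nat.descFactorial_of_lt (Finset.mem_range.1 hi), zero_smul]

/-- If `x` and `y` generate the algebra and `[x, y] = 1`, then so do `x` and `w` whenever
`[x, w] = 1`. -/
theorem adjoin_pair_eq_top_of_commutator [CharZero K] {w : A} (h : x * y - y * x = 1)
    (htop : Algebra.adjoin K {x, y} = ⊤) (hw : x * w - w * x = 1) :
    Algebra.adjoin K {x, w} = ⊤ := by
  have hcomm : Commute x (w - y) := by
    rw [Commute, SemiconjBy, ← sub_eq_zero,
      show x * (w - y) - (w - y) * x = (x * w - w * x) - (x * y - y * x) by noncomm_ring, h, hw,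
      sub_self]
  have hmem : w - y ∈ Algebra.adjoin K {x} := by
    obtain ⟨n, c, hc, hsum⟩ := exists_eq_sum_pow_mul h htop (w - y)
    rw [hsum] at hcomm ⊢
    rcases n with _ | n
    · simp
    · exact sum_mem_adjoin_of_commute h n c hc hcomm
  have hx : x ∈ Algebra.adjoin K {x, w} := Algebra.subset_adjoin (by simp)
  have hw' : w ∈ Algebra.adjoin K {x, w} := Algebra.subset_adjoin (by simp)
  have hy : y ∈ Algebra.adjoin K {x, w} := by
    have := sub_mem hw' (Algebra.adjoin_mono (by simp : ({x} : Set A) ⊆ {x, w}) hmem)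
    rwa [sub_sub_cancel] at this
  rw [eq_top_iff, ← htop, Algebra.adjoin_le_iff]
  rintro u (rfl | rfl)
  exacts [hx, hy]

/-- If `x` and `y` generate the algebra and `[x, y] = 1`, then so do `c x + u` and `w` whenever
`c ≠ 0`, `u` is a polynomial in `y`, and `[c x + u, w] = 1`. -/
theorem adjoin_smul_add_eq_top_of_commutator [CharZero K] (h : x * y - y * x = 1)
    (htop : Algebra.adjoin K {x, y} = ⊤) {c : K} (hc : c ≠ 0) {u w : A}
    (hu : u ∈ Algebra.adjoin K {y}) (hw : (c • x + u) * w - w * (c • x + u) = 1) :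
    Algebra.adjoin K {c • x + u, w} = ⊤ := by
  set z := c • x + u with hz
  refine adjoin_pair_eq_top_of_commutator (y := c⁻¹ • y) ?_ ?_ hw
  · rw [hz, add_mul, mul_add, mul_smul_comm (c⁻¹) u, smul_mul_assoc (c⁻¹) y u,
      (commute_of_mem_adjoin_singleton hu).eq, add_sub_add_right_eq_sub, smul_mul_smul_comm,
      smul_mul_smul_comm, mul_inv_cancel₀ hc, inv_mul_cancel₀ hc, one_smul, one_smul, h]
  · have h1 : z ∈ Algebra.adjoin K {z, c⁻¹ • y} := Algebra.subset_adjoin (by simp)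
    have hy : y ∈ Algebra.adjoin K {z, c⁻¹ • y} := by
      have h2 : c⁻¹ • y ∈ Algebra.adjoin K {z, c⁻¹ • y} := Algebra.subset_adjoin (by simp)
      simpa [smul_smul, hc] using Subalgebra.smul_mem _ h2 c
    have hu' : u ∈ Algebra.adjoin K {z, c⁻¹ • y} :=
      Algebra.adjoin_le (Set.singleton_subset_iff.2 hy) hu
    have hx : x ∈ Algebra.adjoin K {z, c⁻¹ • y} := by
      simpa [hz, smul_smul, hc] using Subalgebra.smul_mem _ (sub_mem h1 hu') c⁻¹
    rw [eq_top_iff, ← htop, Algebra.adjoin_le_iff]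
    rintro v (rfl | rfl)
    exacts [hx, hy]

end Slice

/-! ### Rotating a pair with commutator `1`. -/

section Rotation

variable {A : Type*} [Ring A] {x y : A}

theorem commutator_neg_right (h : x * y - y * x = 1) : y * -x - -x * y = 1 := by
  rw [mul_neg, neg_mul, sub_neg_eq_add, neg_add_eq_sub, h]

theorem commutator_neg_left (h : x * y - y * x = 1) : -y * x - x * -y = 1 := by
  rw [mul_neg, neg_mul, sub_neg_eq_add, neg_add_eq_sub, h]

end Rotation

/-! ### Generators and universal property of the Weyl algebra. -/

namespace WeylAlgebra

variable {K : Type*} [Field K]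

theorem p_mul_q : p K * q K = q K * p K + 1 := by
  rw [p, q, ← map_mul, RingQuot.mkAlgHom_rel K (WeylRel.comm (K := K)), map_add, map_mul, map_one]

theorem commutator_p_q : p K * q K - q K * p K = 1 := by
  rw [p_mul_q, add_sub_cancel_left]

theorem adjoin_p_q : Algebra.adjoin K {p K, q K} = ⊤ := by
  rw [eq_top_iff]
  intro u _
  obtain ⟨a, rfl⟩ := RingQuot.mkAlgHom_surjective K (WeylRel K) u
  induction a using FreeAlgebra.induction with
  | grade0 c => rw [AlgHom.commutes]; exact Subalgebra.algebraMap_mem _ c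
  | grade1 i =>
    fin_cases i
    · exact Algebra.subset_adjoin (Or.inl rfl)
    · exact Algebra.subset_adjoin (Or.inr rfl)
  | mul a b ha hb => rw [map_mul]; exact mul_mem (ha trivial) (hb trivial)
  | add a b ha hb => rw [map_add]; exact add_mem (ha trivial) (hb trivial)

theorem adjoin_eq_top_of_mem {S : Subalgebra K (WeylAlgebra K)} (hp : p K ∈ S) (hq : q K ∈ S) :
    S = ⊤ := by
  rw [eq_top_iff, ← adjoin_p_q, Algebra.adjoin_le_iff]
  rintro u (rfl | rfl)
  exacts [hp, hq]

theorem adjoin_q_neg_p : Algebra.adjoin K {q K, -p K} = ⊤ := by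
  refine adjoin_eq_top_of_mem ?_ (Algebra.subset_adjoin (by simp))
  have h : -p K ∈ Algebra.adjoin K {q K, -p K} := Algebra.subset_adjoin (by simp)
  simpa using neg_mem h

section Lift

variable {A : Type*} [Ring A] [Algebra K A]

/-- The algebra homomorphism from the Weyl algebra determined by a pair with commutator `1`. -/
noncomputable def lift (x y : A) (h : x * y - y * x = 1) : WeylAlgebra K →ₐ[K] A :=
  RingQuot.liftAlgHom K ⟨FreeAlgebra.lift K ![x, y], by
    rintro _ _ ⟨⟩
    simp [← h]⟩

@[simp] theorem lift_p (x y : A) (h : x * y - y * x = 1) : lift x y h (p K) = x := by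
  simp [lift, p]

@[simp] theorem lift_q (x y : A) (h : x * y - y * x = 1) : lift x y h (q K) = y := by
  simp [lift, q]

theorem algHom_ext {φ ψ : WeylAlgebra K →ₐ[K] A} (hp : φ (p K) = ψ (p K))
    (hq : φ (q K) = ψ (q K)) : φ = ψ := by
  refine AlgHom.ext_of_adjoin_eq_top adjoin_p_q ?_
  rintro u (rfl | rfl)
  exacts [hp, hq]

end Lift

/-! ### Homogeneous elements as polynomials in `pq` times a power of `p` or `q`. -/

section HomogeneousForm

variable (K) in
/-- The degree zero element `p q`. -/
noncomputable def h : WeylAlgebra K := p K * q K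

theorem p_mul_aeval (f : K[X]) : p K * aeval (h K) f = aeval (h K) (taylor 1 f) * p K := by
  induction f using Polynomial.induction_on' with
  | add f g hf hg => rw [map_add, map_add, map_add, mul_add, add_mul, hf, hg]
  | monomial n a =>
    have h1 : p K * h K = (h K + 1) * p K := by
      rw [h, add_mul, one_mul, mul_assoc, ← mul_add_one, ← p_mul_q]
    have h2 : SemiconjBy (p K) (h K ^ n) ((h K + 1) ^ n) := SemiconjBy.pow_right h1 n
    rw [taylor_monomial, aeval_monomial, map_mul, map_pow, map_add, aeval_X, aeval_C, aeval_C,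
      map_one, ← mul_assoc, ← Algebra.commutes a (p K), mul_assoc, h2.eq, mul_assoc]

theorem p_pow_mul_aeval (t : ℕ) (f : K[X]) :
    p K ^ t * aeval (h K) f = aeval (h K) (taylor (t : K) f) * p K ^ t := by
  induction t generalizing f with
  | zero => simp
  | succ t ih =>
    rw [pow_succ, mul_assoc, p_mul_aeval, ← mul_assoc, ih, taylor_taylor, mul_assoc]
    push_cast
    rfl

theorem exists_p_pow_mul_q_pow (i : ℕ) : ∃ f : K[X], p K ^ i * q K ^ i = aeval (h K) f := by
  induction i with
  | zero => exact ⟨1, by simp⟩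
  | succ i ih =>
    obtain ⟨f, hf⟩ := ih
    refine ⟨taylor 1 f * X, ?_⟩
    rw [pow_succ', pow_succ, mul_assoc, ← mul_assoc (p K ^ i), hf, ← mul_assoc, p_mul_aeval,
      mul_assoc, map_mul, aeval_X, h]

theorem exists_eq_aeval_mul_q_pow {t : ℕ} {z : WeylAlgebra K} (hz : z ∈ D K t) :
    ∃ f : K[X], z = aeval (h K) f * q K ^ t := by
  induction hz using Submodule.span_induction with
  | mem z hz =>
    obtain ⟨i, s, hst, rfl⟩ := hz
    obtain rfl : s = i + t := by lia
    obtain ⟨f, hf⟩ := exists_p_pow_mul_q_pow (K := K) i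
    exact ⟨f, by rw [pow_add, ← mul_assoc, hf]⟩
  | zero => exact ⟨0, by simp⟩
  | add a b _ _ ha hb =>
    obtain ⟨f, rfl⟩ := ha
    obtain ⟨g, rfl⟩ := hb
    exact ⟨f + g, by rw [map_add, add_mul]⟩
  | smul c a _ ha =>
    obtain ⟨f, rfl⟩ := ha
    exact ⟨c • f, by rw [map_smul, smul_mul_assoc]⟩

theorem exists_eq_aeval_mul_p_pow {t : ℕ} {z : WeylAlgebra K} (hz : z ∈ D K (-t)) :
    ∃ f : K[X], z = aeval (h K) f * p K ^ t := by
  induction hz using Submodule.span_induction with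
  | mem z hz =>
    obtain ⟨i, s, hst, rfl⟩ := hz
    obtain rfl : i = t + s := by lia
    obtain ⟨f, hf⟩ := exists_p_pow_mul_q_pow (K := K) s
    exact ⟨taylor (t : K) f, by rw [pow_add, mul_assoc, hf, p_pow_mul_aeval]⟩
  | zero => exact ⟨0, by simp⟩
  | add a b _ _ ha hb =>
    obtain ⟨f, rfl⟩ := ha
    obtain ⟨g, rfl⟩ := hb
    exact ⟨f + g, by rw [map_add, add_mul]⟩
  | smul c a _ ha =>
    obtain ⟨f, rfl⟩ := ha
    exact ⟨c • f, by rw [map_smul, smul_mul_assoc]⟩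

end HomogeneousForm

/-! ### The map to skew Laurent polynomials and its image. -/

section Embedding

open SkewLaurent

variable (K) in
/-- The homomorphism to skew Laurent polynomials with `p ↦ h x⁻¹` and `q ↦ x`. -/
noncomputable def toSkewLaurent : WeylAlgebra K →ₐ[K] SkewLaurent K :=
  lift (mono (-1) X) (mono 1 1) <| by
    refine ext_cf fun k => ?_
    rw [cf_sub, mono_mul_mono, mono_mul_mono, cf_mono, cf_mono, cf_one]
    split_ifs <;> simp_all

@[simp] theorem toSkewLaurent_p : toSkewLaurent K (p K) = mono (-1) X := lift_p _ _ _

@[simp] theorem toSkewLaurent_q : toSkewLaurent K (q K) = mono 1 1 := lift_q _ _ _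

theorem toSkewLaurent_aeval (f : K[X]) : toSkewLaurent K (aeval (h K) f) = mono 0 f := by
  have hX (n : ℕ) : (mono 0 X : SkewLaurent K) ^ n = mono 0 (X ^ n) := by
    induction n with
    | zero => rw [pow_zero, pow_zero, mono_zero_one]
    | succ n ih =>
      rw [pow_succ, ih, mono_mul_mono, pow_succ]
      simp
  induction f using Polynomial.induction_on' with
  | add f g hf hg => rw [map_add, map_add, hf, hg, mono_add]
  | monomial n a =>
    rw [aeval_monomial, ← Algebra.smul_def, map_smul, map_pow, h, map_mul, toSkewLaurent_p,
      toSkewLaurent_q, mono_mul_mono, taylor_one, C_1, mul_one, neg_add_cancel, hX, ← mono_smul,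
      ← C_mul_X_pow_eq_monomial, smul_eq_C_mul]

theorem toSkewLaurent_q_pow (t : ℕ) : toSkewLaurent K (q K ^ t) = mono t 1 := by
  induction t with
  | zero => simp [mono_zero_one]
  | succ t ih =>
    rw [pow_succ, map_mul, ih, toSkewLaurent_q, mono_mul_mono]
    simp

theorem toSkewLaurent_p_pow (t : ℕ) :
    toSkewLaurent K (p K ^ t) = mono (-t) (ascPochhammer K t) := by
  induction t with
  | zero => simp [mono_zero_one]
  | succ t ih =>
    rw [pow_succ', map_mul, ih, toSkewLaurent_p, mono_mul_mono, ascPochhammer_succ_left]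
    simp [taylor_apply, add_comm]

theorem toSkewLaurent_aeval_mul_q_pow (f : K[X]) (t : ℕ) :
    toSkewLaurent K (aeval (h K) f * q K ^ t) = mono t f := by
  rw [map_mul, toSkewLaurent_aeval, toSkewLaurent_q_pow, mono_mul_mono]
  simp

theorem toSkewLaurent_aeval_mul_p_pow (f : K[X]) (t : ℕ) :
    toSkewLaurent K (aeval (h K) f * p K ^ t) = mono (-t) (f * ascPochhammer K t) := by
  rw [map_mul, toSkewLaurent_aeval, toSkewLaurent_p_pow, mono_mul_mono]
  simp

theorem ascPochhammer_dvd_cf_toSkewLaurent (w : WeylAlgebra K) (n : ℕ) :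
    ascPochhammer K n ∣ cf (toSkewLaurent K w) (-n) := by
  -- Phrased as stability under left multiplication, the claim passes to products by composition.
  suffices H : ∀ u : SkewLaurent K, (∀ n : ℕ, ascPochhammer K n ∣ cf u (-n)) →
      ∀ n : ℕ, ascPochhammer K n ∣ cf (toSkewLaurent K w * u) (-n) by
    rw [← mul_one (toSkewLaurent K w)]
    refine H 1 (fun m => ?_) n
    rcases m with _ | m
    · simp
    · rw [cf_one, if_neg (by lia)]
      exact dvd_zero _
  have hw : w ∈ Algebra.adjoin K {p K, q K} := by
    rw [adjoin_p_q]
    exact Algebra.mem_top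
  induction hw using Algebra.adjoin_induction with
  | mem w hw =>
    intro u hu n
    rcases hw with rfl | hw
    · rw [toSkewLaurent_p, cf_mono_mul]
      rcases n with _ | n
      · simp
      rw [ascPochhammer_succ_left, show -((n + 1 : ℕ) : ℤ) - -1 = -n by push_cast; ring]
      refine mul_dvd_mul_left _ ?_
      have h1 := map_dvd (taylorAlgHom (1 : K)) (hu n)
      simpa [taylor_apply] using h1
    · rw [Set.mem_singleton_iff.1 hw, toSkewLaurent_q, cf_mono_mul, one_mul,
        show -(n : ℤ) - 1 = -(n + 1 : ℕ) by push_cast; ring]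
      -- Shifting `X (X+1)...(X+n)` by `-1` gives `X - 1` times the rising factorial of length `n`.
      have h1 := map_dvd (taylorAlgHom (-1 : K)) (hu (n + 1))
      have h2 : taylorAlgHom (-1 : K) ((ascPochhammer K n).comp (X + 1)) = ascPochhammer K n := by
        rw [← C_1, ← taylor_apply]
        change taylor (-1) (taylor 1 _) = _
        rw [taylor_taylor, neg_add_cancel, taylor_zero]
      rw [ascPochhammer_succ_left, map_mul, h2] at h1
      simpa using dvd_of_mul_left_dvd h1
  | algebraMap c =>
    intro u hu n
    rw [AlgHom.commutes, ← Algebra.smul_def, cf_smul, smul_eq_C_mul]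
    exact (hu n).mul_left _
  | add a b _ _ ha hb =>
    intro u hu n
    rw [map_add, add_mul, cf_add]
    exact dvd_add (ha u hu n) (hb u hu n)
  | mul a b _ _ ha hb =>
    intro u hu n
    rw [map_mul, mul_assoc]
    exact ha _ (hb u hu) n

theorem le_natDegree_cf_toSkewLaurent (w : WeylAlgebra K) (k : ℤ) (hk : k < 0)
    (h0 : cf (toSkewLaurent K w) k ≠ 0) : -k ≤ (cf (toSkewLaurent K w) k).natDegree := by
  obtain ⟨n, rfl⟩ : ∃ n : ℕ, k = -n := ⟨k.natAbs, by lia⟩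
  have := natDegree_le_of_dvd (ascPochhammer_dvd_cf_toSkewLaurent w n) h0
  rw [ascPochhammer_natDegree] at this
  lia

end Embedding

/-! ### The Fourier automorphism, which negates degrees. -/

section Fourier

variable (K) in
/-- The automorphism with `p ↦ q` and `q ↦ -p`. -/
noncomputable def fourier : WeylAlgebra K ≃ₐ[K] WeylAlgebra K :=
  AlgEquiv.ofAlgHom
    (lift (q K) (-p K) (commutator_neg_right commutator_p_q))
    (lift (-q K) (p K) (commutator_neg_left commutator_p_q))
    (algHom_ext (by simp) (by simp)) (algHom_ext (by simp) (by simp))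

@[simp] theorem fourier_p : fourier K (p K) = q K := lift_p _ _ _

@[simp] theorem fourier_q : fourier K (q K) = -p K := lift_q _ _ _

theorem q_mul_mem_D {t : ℤ} {z : WeylAlgebra K} (hz : z ∈ D K t) : q K * z ∈ D K (t + 1) := by
  induction hz using Submodule.span_induction with
  | mem z hz =>
    obtain ⟨i, s, hst, rfl⟩ := hz
    -- In the opposite ring `q` and `p` again have commutator `1`, in this order.
    have h1 := mul_pow_eq_of_commutator_eq_one (R := (WeylAlgebra K)ᵐᵒᵖ)
      (x := MulOpposite.op (q K)) (y := MulOpposite.op (p K))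
      (by rw [← MulOpposite.op_mul, ← MulOpposite.op_mul, ← MulOpposite.op_sub, commutator_p_q,
        MulOpposite.op_one]) i
    have h2 : p K ^ i * q K = q K * p K ^ i + p K ^ (i - 1) * i := by
      simpa using congrArg MulOpposite.unop h1
    rw [← mul_assoc, eq_sub_of_add_eq h2.symm, sub_mul, mul_assoc, ← pow_succ', mul_assoc,
      (Nat.cast_commute i _).eq, ← mul_assoc, ← Nat.cast_comm, ← nsmul_eq_mul]
    refine sub_mem (Submodule.subset_span ⟨i, s + 1, by push_cast; lia, rfl⟩) ?_
    rcases i with _ | i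
    · simp
    · exact (D K (t + 1)).smul_of_tower_mem _
        (Submodule.subset_span ⟨i, s, by push_cast at hst; lia, rfl⟩)
  | zero => simp
  | add a b _ _ ha hb => rw [mul_add]; exact add_mem ha hb
  | smul c a _ ha => rw [mul_smul_comm]; exact Submodule.smul_mem _ _ ha

theorem fourier_mem_D {t : ℤ} {z : WeylAlgebra K} (hz : z ∈ D K t) : fourier K z ∈ D K (-t) := by
  induction hz using Submodule.span_induction with
  | mem z hz =>
    obtain ⟨i, s, hst, rfl⟩ := hz
    have hmem : q K ^ i * p K ^ s ∈ D K (-t) := by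
      have (i : ℕ) : q K ^ i * p K ^ s ∈ D K (i - s) := by
        induction i with
        | zero => exact Submodule.subset_span ⟨s, 0, by simp, by simp⟩
        | succ i ih =>
          rw [pow_succ', mul_assoc]
          convert q_mul_mem_D ih using 2
          push_cast
          ring
      convert this i using 2
      lia
    rw [map_mul, map_pow, map_pow, fourier_p, fourier_q]
    rw [← neg_one_smul K (p K), _root_.smul_pow, mul_smul_comm]
    exact Submodule.smul_mem _ _ hmem
  | zero => simp
  | add a b _ _ ha hb => rw [map_add]; exact add_mem ha hb
  | smul c a _ ha => rw [map_smul]; exact Submodule.smul_mem _ _ ha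

theorem adjoin_eq_top_of_fourier {z w : WeylAlgebra K}
    (h : Algebra.adjoin K {fourier K z, fourier K w} = ⊤) : Algebra.adjoin K {z, w} = ⊤ := by
  rw [eq_top_iff]
  intro u _
  have h1 : fourier K u ∈ (Algebra.adjoin K {z, w}).map (fourier K : _ →ₐ[K] WeylAlgebra K) := by
    rw [AlgHom.map_adjoin, Set.image_pair]
    exact h ▸ Algebra.mem_top
  obtain ⟨v, hv, hvu⟩ := h1
  rwa [← (fourier K).injective hvu]

end Fourier

/-! ### Case analysis on the two degrees. -/

section Main

open SkewLaurent

instance : Nontrivial (WeylAlgebra K) :=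
  (toSkewLaurent K).toRingHom.domain_nontrivial

variable [CharZero K]

theorem eq_smul_q_of_commutator {t : ℕ} (ht : 0 < t) {z w : WeylAlgebra K} (hz : z ∈ D K t)
    (h : z * w - w * z = 1) : ∃ c : K, c ≠ 0 ∧ z = c • q K := by
  obtain ⟨f, rfl⟩ := exists_eq_aeval_mul_q_pow hz
  have hf : f ≠ 0 := by rintro rfl; simp at h
  have h1 := congrArg (toSkewLaurent K) h
  -- A zero term in degree `t + 1` is added to fit the two-term lemma.
  rw [map_sub, map_mul _ _ w, map_mul _ w, toSkewLaurent_aeval_mul_q_pow, map_one,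
    ← add_zero (mono (t : ℤ) f), ← mono_zero ((t : ℤ) + 1)] at h1
  obtain ⟨h2, h3, -, -⟩ := lowest_of_commutator (by lia) (by lia) hf
    (le_natDegree_cf_toSkewLaurent w) h1
  obtain rfl : t = 1 := by lia
  obtain ⟨c, rfl⟩ := natDegree_eq_zero.1 h3
  exact ⟨c, by rintro rfl; simp at hf, by rw [aeval_C, pow_one, Algebra.smul_def]⟩

theorem eq_smul_q_add_of_commutator {s t : ℕ} (hst : s < t) {z₁ z₂ w : WeylAlgebra K}
    (hz₁ : z₁ ∈ D K s) (hz₂ : z₂ ∈ D K t) (h : (z₁ + z₂) * w - w * (z₁ + z₂) = 1) :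
    ∃ c d : K, c ≠ 0 ∧ z₁ + z₂ = c • q K + algebraMap K _ d := by
  obtain ⟨f, hf⟩ := exists_eq_aeval_mul_q_pow hz₁
  obtain ⟨g, hg⟩ := exists_eq_aeval_mul_q_pow hz₂
  have h1 := congrArg (toSkewLaurent K) h
  rw [map_sub, map_mul _ _ w, map_mul _ w, map_add, hf, hg, toSkewLaurent_aeval_mul_q_pow,
    toSkewLaurent_aeval_mul_q_pow, map_one] at h1
  rcases Nat.eq_zero_or_pos s with rfl | hs
  · obtain ⟨d, rfl⟩ := natDegree_eq_zero.1 (natDegree_eq_zero_of_commutator (by lia) h1)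
    rw [aeval_C, pow_zero, mul_one] at hf
    have h2 : z₂ * w - w * z₂ = 1 := by
      rwa [hf, add_mul, mul_add, Algebra.commutes d w, add_sub_add_left_eq_sub] at h
    obtain ⟨c, hc, h3⟩ := eq_smul_q_of_commutator (by lia) hz₂ h2
    exact ⟨c, d, hc, by rw [hf, h3, add_comm]⟩
  · by_cases hf0 : f = 0
    · rw [hf0, map_zero, zero_mul] at hf
      rw [hf, zero_add] at h ⊢
      obtain ⟨c, hc, h3⟩ := eq_smul_q_of_commutator (by lia) hz₂ h
      exact ⟨c, 0, hc, by rw [h3, map_zero, add_zero]⟩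
    · obtain ⟨h2, h3, h4, h5⟩ := lowest_of_commutator (by lia) (by lia) hf0
        (le_natDegree_cf_toSkewLaurent w) h1
      obtain rfl : s = 1 := by lia
      have hg0 := eq_zero_of_commutator (by lia) hf0 h3 h4 h5 h1
      rw [hg0, map_zero, zero_mul] at hg
      rw [hg, add_zero] at h ⊢
      obtain ⟨c, hc, h6⟩ := eq_smul_q_of_commutator (by lia) hz₁ h
      exact ⟨c, 0, hc, by rw [h6, map_zero, add_zero]⟩

theorem adjoin_eq_top_of_nonneg {s t : ℕ} (hst : s < t) {z₁ z₂ w : WeylAlgebra K}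
    (hz₁ : z₁ ∈ D K s) (hz₂ : z₂ ∈ D K t) (h : (z₁ + z₂) * w - w * (z₁ + z₂) = 1) :
    Algebra.adjoin K {z₁ + z₂, w} = ⊤ := by
  obtain ⟨c, d, hc, hz⟩ := eq_smul_q_add_of_commutator hst hz₁ hz₂ h
  rw [hz] at h ⊢
  exact adjoin_smul_add_eq_top_of_commutator (commutator_neg_right commutator_p_q) adjoin_q_neg_p hc
    (Subalgebra.algebraMap_mem _ d) h

theorem adjoin_eq_top_of_neg_of_pos {s t : ℕ} (hs : 0 < s) (ht : 0 < t) {z₁ z₂ w : WeylAlgebra K}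
    (hz₁ : z₁ ∈ D K (-s)) (hz₂ : z₂ ∈ D K t) (h₁ : z₁ ≠ 0) (h₂ : z₂ ≠ 0)
    (h : (z₁ + z₂) * w - w * (z₁ + z₂) = 1) :
    Algebra.adjoin K {z₁ + z₂, w} = ⊤ := by
  obtain ⟨f, rfl⟩ := exists_eq_aeval_mul_p_pow hz₁
  obtain ⟨g, rfl⟩ := exists_eq_aeval_mul_q_pow hz₂
  have hf : f ≠ 0 := by rintro rfl; simp at h₁
  have hg : g ≠ 0 := by rintro rfl; simp at h₂
  have h1 := congrArg (toSkewLaurent K) h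
  rw [map_sub, map_mul _ _ w, map_mul _ w, map_add, toSkewLaurent_aeval_mul_p_pow,
    toSkewLaurent_aeval_mul_q_pow, map_one] at h1
  have hdeg : (f * ascPochhammer K s).natDegree = f.natDegree + s := by
    rw [natDegree_mul hf (monic_ascPochhammer K s).ne_zero, ascPochhammer_natDegree]
  -- The rising factorial coming from `p^s` supplies the degree bound; equality then makes `f`
  -- constant.
  obtain ⟨h2, h3, h4⟩ := natDegree_eq_of_binomial_commutator (r := s) (s := t) (by lia) (by lia)
    (mul_ne_zero hf (monic_ascPochhammer K s).ne_zero) hg (by rw [hdeg]; lia) h1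
  obtain ⟨c, rfl⟩ := natDegree_eq_zero.1 (show f.natDegree = 0 by lia)
  obtain ⟨d, rfl⟩ := natDegree_eq_zero.1 h3
  have hc : c ≠ 0 := by rintro rfl; simp at hf
  have hd : d ≠ 0 := by rintro rfl; simp at hg
  simp only [aeval_C, ← Algebra.smul_def] at h ⊢
  rcases h4 with h4 | h4
  · obtain rfl : s = 1 := by lia
    rw [pow_one] at h ⊢
    have hq : q K ∈ Algebra.adjoin K {q K} := Algebra.subset_adjoin (Set.mem_singleton _)
    exact adjoin_smul_add_eq_top_of_commutator commutator_p_q adjoin_p_q hc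
      (Subalgebra.smul_mem _ (pow_mem hq t) d) h
  · obtain rfl : t = 1 := by lia
    rw [pow_one, add_comm] at h ⊢
    have hp : p K ∈ Algebra.adjoin K {-p K} := by
      have hp' : -p K ∈ Algebra.adjoin K {-p K} := Algebra.subset_adjoin (Set.mem_singleton _)
      simpa using neg_mem hp'
    exact adjoin_smul_add_eq_top_of_commutator (commutator_neg_right commutator_p_q)
      adjoin_q_neg_p hd (Subalgebra.smul_mem _ (pow_mem hp s) c) h

theorem adjoin_eq_top_of_lt {s t : ℤ} (hst : s < t) {z₁ z₂ w : WeylAlgebra K}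
    (hz₁ : z₁ ∈ D K s) (hz₂ : z₂ ∈ D K t) (h : (z₁ + z₂) * w - w * (z₁ + z₂) = 1) :
    Algebra.adjoin K {z₁ + z₂, w} = ⊤ := by
  have nonneg {s t : ℤ} (hs : 0 ≤ s) (hst : s < t) {z₁ z₂ w : WeylAlgebra K}
      (hz₁ : z₁ ∈ D K s) (hz₂ : z₂ ∈ D K t) (h : (z₁ + z₂) * w - w * (z₁ + z₂) = 1) :
      Algebra.adjoin K {z₁ + z₂, w} = ⊤ := by
    lift s to ℕ using hs
    lift t to ℕ using by lia
    exact adjoin_eq_top_of_nonneg (by lia) hz₁ hz₂ h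
  have nonpos {s t : ℤ} (ht : t ≤ 0) (hst : s < t) {z₁ z₂ w : WeylAlgebra K}
      (hz₁ : z₁ ∈ D K s) (hz₂ : z₂ ∈ D K t) (h : (z₁ + z₂) * w - w * (z₁ + z₂) = 1) :
      Algebra.adjoin K {z₁ + z₂, w} = ⊤ := by
    refine adjoin_eq_top_of_fourier ?_
    rw [map_add, add_comm]
    refine nonneg (s := -t) (t := -s) (by lia) (by lia) (fourier_mem_D hz₂) (fourier_mem_D hz₁) ?_
    rw [add_comm, ← map_add, ← map_mul, ← map_mul, ← map_sub, h, map_one]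
  rcases le_or_gt 0 s with hs | hs
  · exact nonneg hs hst hz₁ hz₂ h
  rcases le_or_gt t 0 with ht | ht
  · exact nonpos ht hst hz₁ hz₂ h
  by_cases h₁ : z₁ = 0
  · subst h₁
    rw [add_comm] at h ⊢
    exact nonneg ht.le (lt_add_one t) hz₂ (zero_mem _) h
  by_cases h₂ : z₂ = 0
  · subst h₂
    rw [add_comm] at h ⊢
    exact nonpos hs.le (sub_one_lt s) (zero_mem _) hz₁ h
  obtain ⟨m, rfl⟩ : ∃ m : ℕ, s = -m := ⟨s.natAbs, by lia⟩
  lift t to ℕ using ht.le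
  exact adjoin_eq_top_of_neg_of_pos (by lia) (by lia) hz₁ hz₂ h₁ h₂ h

end Main

end WeylAlgebra

theorem theorem97 {K : Type*} [Field K] [CharZero K] (z w : WeylAlgebra K)
    (hzw : z * w - w * z = 1)
    (hz : ∃ z₁ z₂ : WeylAlgebra K,
      WeylAlgebra.IsHomogeneous z₁ ∧ WeylAlgebra.IsHomogeneous z₂ ∧ z = z₁ + z₂) :
    Algebra.adjoin K ({z, w} : Set (WeylAlgebra K)) = ⊤ := by
  obtain ⟨z₁, z₂, ⟨s, hs⟩, ⟨t, ht⟩, rfl⟩ := hz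
  rcases lt_trichotomy s t with hst | rfl | hst
  · exact WeylAlgebra.adjoin_eq_top_of_lt hst hs ht hzw
  -- Equal degrees: the sum is homogeneous, and zero serves as the second term.
  · have := WeylAlgebra.adjoin_eq_top_of_lt (lt_add_one s) (add_mem hs ht)
      (zero_mem (WeylAlgebra.D K (s + 1))) (w := w)
    rw [add_zero] at this
    exact this hzw
  · rw [add_comm] at hzw ⊢
    exact WeylAlgebra.adjoin_eq_top_of_lt hst ht hs hzw
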